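/- A \emph{diffeo} is an analytic germ of identity-tangent diffeomorphism at $\infty$, $f(z)=z+\sum_{s\ge1}f_s z^{1-s}$ (a series convergent for $|z|$ large); dropping convergence gives formal diffeos. Both form groups under composition. Let $\sigma(z)=-z$, $l(z)=z+1$, let $\bar f$ be $f$ with all coefficients replaced by their complex conjugates, and $\check f:=\sigma\circ f\circ\sigma$. Call $f$ \emph{reflexive} if $\check f=f^{-1}$, \emph{unitary} if $\bar f=f^{-1}$, \emph{counitary} if $\check{\bar f}=f^{-1}$. Call $f$ \emph{weakly reflexive} (resp. \emph{weakly counitary}) if $\check f$ (resp. $\check{\bar f}$) is conjugate to $f^{-1}$ by a diffeo $k$ normalised by $k(z)=z+o(1)$. A \emph{formal iterator} of $f$ is a formal diffeo $f^\ast(z)=z+o(1)$ with $f^\ast\circ f=l\circ f^\ast$; write ${}^{\ast}\!f$ for its inverse. (a) If $f_1,f_2$ are reflexive (resp. unitary, counitary) diffeos, then $f_1\circ f_2$ and $f_1\circ f_2^{-1}$ are each conjugate, by a diffeo $h(z)=z+a+o(1)$, to a reflexive (resp. unitary, counitary) diffeo. (b) Let $f(z)=z+1+o(1)$ be a weakly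 reflexive (resp. weakly counitary) diffeo. Then there is a diffeo $h(z)=z+o(1)$ such that $h\circ f\circ h^{-1}$ is reflexive (resp. counitary). For every such $h$ and all integers $n_1,n_2$ with $n_1-n_2=1$, the germs $$f_j:=f^{n_j}\circ h^{-1}\circ\sigma\circ h\circ\sigma\qquad\bigl(\text{resp. } f_j:=f^{n_j}\circ h^{-1}\circ\sigma\circ\bar h\circ\sigma\bigr)\qquad(j=1,2)$$ are analytic reflexive (resp. counitary) diffeos, $f_j(z)=z+n_j+o(1)$, and $f=f_1\circ f_2^{-1}$. Moreover $f$ has exactly one formal iterator $f^\ast$ (in the counitary case: provided $f(z)=z+1+O(z^{-2})$), and whenever $f^\ast$ is a formal iterator of $f$, $$f_j={}^{\ast}\!f\circ l^{n_j}\circ\sigma\circ f^\ast\circ\sigma=f^{n_j}\circ{}^{\ast}\!f\circ\sigma\circ f^\ast\circ\sigma$$ as formal diffeos (resp. the same with $\sigma\circ\overline{f^\ast}\circ\sigma$ in place of $\sigma\circ f^\ast\circ\sigma$). (c) More generally, let $f(z)=z+1+o(1)$ be a diffeo and $h(z)=z+a+o(1)$ any diffeo such that $h\circ f\circ h^{-1}$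 is reflexive (resp. counitary). Then for all integers $n_1-n_2=1$ the germs $f_j$ defined from $h$ as in (b) are analytic reflexive (resp. counitary) diffeos, $f=f_1\circ f_2^{-1}$, and $f_j(z)=z+n_j-2a+o(1)$ (resp. $f_j(z)=z+n_j-2\operatorname{Re}(a)+o(1)$). -/

import Mathlib

open scoped PowerSeries

noncomputable section

/-- A formal identity-tangent diffeomorphism at infinity
`f(z) = z + ∑_{s ≥ 1} f_s z^{1-s}`, recorded by the power series
`tail = ∑_{s ≥ 1} f_s X^{s-1}` in the variable `X = 1/z`, so that `f(z) = z + tail(1/z)`. -/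
@[ext]
structure FormalDiffeo where
  tail : ℂ⟦X⟧

namespace FormalDiffeo

/-- The expansion of `1 / f(z)` in powers of `X = 1/z`, namely `X / (1 + X * tail)`. -/
def recip (f : FormalDiffeo) : ℂ⟦X⟧ :=
  PowerSeries.X * (1 + PowerSeries.X * f.tail)⁻¹

/-- The identity map `z`. -/
instance : One FormalDiffeo := ⟨⟨0⟩⟩

/-- Multiplication is composition: `(f * g)(z) = f(g(z)) = z + tail_g(1/z) + tail_f(1/g(z))`. -/
instance : Mul FormalDiffeo := ⟨fun f g => ⟨g.tail + f.tail.subst g.recip⟩⟩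

theorem one_tail : (1 : FormalDiffeo).tail = 0 := rfl

theorem mul_tail (f g : FormalDiffeo) :
    (f * g).tail = g.tail + f.tail.subst g.recip := rfl

theorem recip_mul (f : FormalDiffeo) :
    f.recip * (1 + PowerSeries.X * f.tail) = PowerSeries.X := by
  unfold recip
  rw [mul_assoc, PowerSeries.inv_mul_cancel _ (by simp), mul_one]

theorem constantCoeff_recip (f : FormalDiffeo) : PowerSeries.constantCoeff f.recip = 0 := by
  simp [recip]

theorem coeff_one_recip (f : FormalDiffeo) : PowerSeries.coeff 1 f.recip = 1 := by
  rw [recip, show (1 : ℕ) = 0 + 1 from rfl, PowerSeries.coeff_succ_X_mul]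
  simp

theorem hasSubst_recip (f : FormalDiffeo) : PowerSeries.HasSubst f.recip :=
  PowerSeries.HasSubst.of_constantCoeff_zero' f.constantCoeff_recip

theorem one_add_ne_zero (f : FormalDiffeo) : (1 + PowerSeries.X * f.tail : ℂ⟦X⟧) ≠ 0 := by
  intro h
  simpa using congrArg PowerSeries.constantCoeff h

theorem recip_comp (f g : FormalDiffeo) : (f * g).recip = f.recip.subst g.recip := by
  have hg := g.hasSubst_recip
  have h1 : f.recip.subst g.recip * (1 + g.recip * f.tail.subst g.recip) = g.recip := by
    have h := congrArg (PowerSeries.subst g.recip) f.recip_mul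
    have e : PowerSeries.subst g.recip (1 : ℂ⟦X⟧) = (1 : ℂ⟦X⟧) := by
      rw [← PowerSeries.coe_substAlgHom hg, map_one]
    rw [PowerSeries.subst_mul hg, PowerSeries.subst_add hg, PowerSeries.subst_mul hg,
      PowerSeries.subst_X hg, e] at h
    exact h
  have h2 := g.recip_mul
  have h3 := (f * g).recip_mul
  rw [mul_tail] at h3
  apply mul_right_cancel₀ ((f * g).one_add_ne_zero)
  rw [mul_tail, h3]
  linear_combination (-(1 + PowerSeries.X * g.tail)) * h1
    + (f.recip.subst g.recip * f.tail.subst g.recip - 1) * h2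

theorem exists_left_inv (f : FormalDiffeo) : ∃ g : FormalDiffeo, g * f = 1 := by
  have hu : IsUnit (PowerSeries.coeff 1 f.recip) := by
    rw [coeff_one_recip]
    exact isUnit_one
  refine ⟨⟨-(f.tail.subst (f.recip.substInvOfIsUnit hu))⟩, ?_⟩
  ext1
  rw [mul_tail, one_tail, ← PowerSeries.coe_substAlgHom f.hasSubst_recip, map_neg,
    PowerSeries.coe_substAlgHom f.hasSubst_recip,
    PowerSeries.subst_comp_subst_apply (PowerSeries.HasSubst.substInvOfIsUnit _ hu)
      f.hasSubst_recip,
    PowerSeries.subst_substInvOfIsUnit_left _ f.constantCoeff_recip, PowerSeries.X_subst,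
    add_neg_cancel]

/-- The inverse for composition. -/
instance : Inv FormalDiffeo := ⟨fun f => f.exists_left_inv.choose⟩

/-- Formal identity-tangent diffeomorphisms form a group under composition. -/
instance : Group FormalDiffeo :=
  Group.ofLeftAxioms
    (fun f g h => by
      ext1
      rw [mul_tail, mul_tail, mul_tail, mul_tail, recip_comp,
        PowerSeries.subst_add h.hasSubst_recip,
        PowerSeries.subst_comp_subst_apply g.hasSubst_recip h.hasSubst_recip, add_assoc])
    (fun f => by
      ext1
      rw [mul_tail, one_tail, ← PowerSeries.coe_substAlgHom f.hasSubst_recip, map_zero, add_zero])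
    (fun f => f.exists_left_inv.choose_spec)

/-- The constant `a` in `f(z) = z + a + o(1)`. -/
def shift (f : FormalDiffeo) : ℂ := PowerSeries.constantCoeff f.tail

/-- `f` is an analytic germ at infinity: `∑_{s ≥ 1} f_s z^{1-s}` converges for `|z|` large,
that is, its coefficients grow at most geometrically. -/
def IsAnalytic (f : FormalDiffeo) : Prop :=
  ∃ C r : ℝ, ∀ n : ℕ, ‖PowerSeries.coeff n f.tail‖ ≤ C * r ^ n

/-- The unit shift `l(z) = z + 1`. -/
def l : FormalDiffeo := ⟨1⟩

/-- `σ ∘ f ∘ σ` with `σ(z) = -z`, that is, `z - tail(-1/z)`. -/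
def check (f : FormalDiffeo) : FormalDiffeo := ⟨-PowerSeries.rescale (-1) f.tail⟩

/-- The complex conjugate of `f`, that is, the conjugate of `f(conj z)`: all the
coefficients are replaced by their conjugates. -/
def bar (f : FormalDiffeo) : FormalDiffeo := ⟨PowerSeries.map (starRingEnd ℂ) f.tail⟩

def IsReflexive (f : FormalDiffeo) : Prop := check f = f⁻¹

def IsUnitary (f : FormalDiffeo) : Prop := bar f = f⁻¹

def IsCounitary (f : FormalDiffeo) : Prop := check (bar f) = f⁻¹

/-- Analytic conjugacy: `g = h ∘ f ∘ h⁻¹` with an analytic `h(z) = z + a + o(1)`, `a` arbitrary. -/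
def AnConj (f g : FormalDiffeo) : Prop :=
  ∃ h : FormalDiffeo, IsAnalytic h ∧ h * f * h⁻¹ = g

/-- Normalised analytic conjugacy: `g = h ∘ f ∘ h⁻¹` with an analytic `h(z) = z + o(1)`. -/
def NormAnConj (f g : FormalDiffeo) : Prop :=
  ∃ h : FormalDiffeo, IsAnalytic h ∧ shift h = 0 ∧ h * f * h⁻¹ = g

def IsWeaklyReflexive (f : FormalDiffeo) : Prop := NormAnConj (check f) f⁻¹

def IsWeaklyCounitary (f : FormalDiffeo) : Prop := NormAnConj (check (bar f)) f⁻¹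

/-- `F` is a formal iterator `f^*` of `f`: `f^* ∘ f = l ∘ f^*` with `f^*(z) = z + o(1)`. -/
def IsIterator (f F : FormalDiffeo) : Prop := F * f = l * F ∧ shift F = 0

/-- The factor `f^n ∘ h⁻¹ ∘ σ ∘ h ∘ σ`. -/
def reflexiveFactor (f h : FormalDiffeo) (n : ℤ) : FormalDiffeo := f ^ n * h⁻¹ * check h

/-- The factor `f^n ∘ h⁻¹ ∘ σ ∘ bar h ∘ σ`. -/
def counitaryFactor (f h : FormalDiffeo) (n : ℤ) : FormalDiffeo := f ^ n * h⁻¹ * check (bar h)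

end FormalDiffeo

end

/-!
All the symmetries in the theorem (`f ↦ σ ∘ f ∘ σ`, complex conjugation, and their composite) are
involutive automorphisms `α` of the group of diffeos, and the three notions of reflexive, unitary
and counitary germ all read `α f = f⁻¹`. Apart from two inputs the theorem is group theory
in the presence of such an `α`.

The first input is a linearisation: if `α k * k = 1`, then the mean `h = (id + k) / 2`, taken for
the additive structure, satisfies `α h * k = h`, because composition is additive in its left factor
(`average_mul_of_mul_eq_one`, `IsSymmetry.map_average_mul`). Hence, if `k * α f * k⁻¹ = f⁻¹`, the
mean `h` of `id` and `k⁻¹` conjugates `f` to a germ inverted by `α` (`IsSymmetry.map_conj_average`).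
For a product `f₁ * f₂` of germs inverted by `α` one takes `k = f₁`. No convergence problem arises
in the mean, and only the closure of analytic germs under composition and inversion is needed; it
is obtained from bounds for the partial sums `truncNorm` of a weighted `ℓ¹` norm.

The second input is formal: a diffeo `z + o(1)` commuting with some `f = z + c + o(1)`, `c ≠ 0`, is
the identity (`eq_one_of_commute`), and `f = z + 1 + O(z⁻²)` has a formal iterator
(`exists_isIterator`). Both come from the fact that `Φ ↦ Φ ∘ f - Φ` sends `z⁻ⁿ` to
`-n c z⁻ⁿ⁻¹ + ⋯`. If `k` conjugates `α f` to `f⁻¹`, then `k * α k` commutes with `f`, so that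
`k * α k = 1` and the linearisation applies. In the reflexive case the condition `O(z⁻²)` is
automatic, because the coefficient of `z⁻¹` is a homomorphism to `ℂ`, fixed by `f ↦ σ ∘ f ∘ σ`.
Finally, a formal iterator of a germ inverted by `α` is fixed by `α`, by uniqueness. This gives
`h⁻¹ * α h = F⁻¹ * α F` for any iterator `F` of `f`, hence the formula for the factors.
-/

open scoped PowerSeries
open Finset.HasAntidiagonal (antidiagonal mem_antidiagonal)

namespace FormalDiffeo

/-! ### Partial sums of weighted norms of power series -/

/-- The partial sum of order `n` of the norm `∑ ‖pₖ‖ ρ ^ k` of a power series. Bounds that are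
uniform in `n` express convergence. -/
noncomputable def truncNorm (ρ : ℝ) (n : ℕ) (p : ℂ⟦X⟧) : ℝ :=
  ∑ k ∈ Finset.range n, ‖PowerSeries.coeff k p‖ * ρ ^ k

theorem truncNorm_nonneg {ρ : ℝ} (hρ : 0 ≤ ρ) (n : ℕ) (p : ℂ⟦X⟧) : 0 ≤ truncNorm ρ n p :=
  Finset.sum_nonneg fun _ _ => by positivity

theorem truncNorm_mono {ρ ρ' : ℝ} (hρ : 0 ≤ ρ) (h : ρ ≤ ρ') (n : ℕ) (p : ℂ⟦X⟧) :
    truncNorm ρ n p ≤ truncNorm ρ' n p :=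
  Finset.sum_le_sum fun _ _ => by gcongr

theorem truncNorm_add_le {ρ : ℝ} (hρ : 0 ≤ ρ) (n : ℕ) (p q : ℂ⟦X⟧) :
    truncNorm ρ n (p + q) ≤ truncNorm ρ n p + truncNorm ρ n q := by
  rw [truncNorm, truncNorm, truncNorm, ← Finset.sum_add_distrib]
  refine Finset.sum_le_sum fun k _ => ?_
  rw [map_add, ← add_mul]
  gcongr
  exact norm_add_le _ _

theorem truncNorm_neg (ρ : ℝ) (n : ℕ) (p : ℂ⟦X⟧) : truncNorm ρ n (-p) = truncNorm ρ n p := by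
  simp [truncNorm]

theorem truncNorm_one_le (ρ : ℝ) (n : ℕ) : truncNorm ρ n 1 ≤ 1 := by
  cases n with
  | zero => simp [truncNorm]
  | succ n => rw [truncNorm, Finset.sum_range_succ']; simp [PowerSeries.coeff_one]

theorem truncNorm_mul_le {ρ : ℝ} (hρ : 0 ≤ ρ) (n : ℕ) (p q : ℂ⟦X⟧) :
    truncNorm ρ n (p * q) ≤ truncNorm ρ n p * truncNorm ρ n q := by
  set g : ℕ × ℕ → ℝ := fun x =>
    ‖PowerSeries.coeff x.1 p‖ * ρ ^ x.1 * (‖PowerSeries.coeff x.2 q‖ * ρ ^ x.2) with hg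
  have h0 : ∀ x, 0 ≤ g x := fun x => by simp only [hg]; positivity
  have h1 : ∀ k, ‖PowerSeries.coeff k (p * q)‖ * ρ ^ k ≤ ∑ x ∈ antidiagonal k, g x := by
    intro k
    rw [PowerSeries.coeff_mul]
    refine (mul_le_mul_of_nonneg_right (norm_sum_le _ _) (by positivity)).trans ?_
    rw [Finset.sum_mul]
    refine Finset.sum_le_sum fun x hx => ?_
    rw [← mem_antidiagonal.mp hx, norm_mul, pow_add]
    exact le_of_eq (by simp only [hg]; ring)
  calc truncNorm ρ n (p * q)
      ≤ ∑ k ∈ Finset.range n, ∑ x ∈ antidiagonal k, g x :=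
        Finset.sum_le_sum fun k _ => h1 k
    _ = ∑ x ∈ (Finset.range n).biUnion antidiagonal, g x := by
        rw [Finset.sum_biUnion]
        intro a _ b _ hab
        exact Finset.disjoint_left.mpr fun x hx hy =>
          hab ((mem_antidiagonal.mp hx).symm.trans (mem_antidiagonal.mp hy))
    _ ≤ ∑ x ∈ Finset.range n ×ˢ Finset.range n, g x := by
        refine Finset.sum_le_sum_of_subset_of_nonneg (fun x hx => ?_) fun x _ _ => h0 x
        simp only [Finset.mem_biUnion, Finset.mem_range, mem_antidiagonal,
          Finset.mem_product] at hx ⊢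
        omega
    _ = truncNorm ρ n p * truncNorm ρ n q := by
        rw [Finset.sum_product, truncNorm, truncNorm, Finset.sum_mul_sum]

theorem truncNorm_pow_le {ρ : ℝ} (hρ : 0 ≤ ρ) (n : ℕ) (p : ℂ⟦X⟧) (k : ℕ) :
    truncNorm ρ n (p ^ k) ≤ truncNorm ρ n p ^ k := by
  induction k with
  | zero => simpa using truncNorm_one_le ρ n
  | succ k ih =>
    rw [pow_succ, pow_succ]
    exact (truncNorm_mul_le hρ n _ _).trans
      (mul_le_mul_of_nonneg_right ih (truncNorm_nonneg hρ n p))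

theorem truncNorm_X_mul (ρ : ℝ) (n : ℕ) (p : ℂ⟦X⟧) :
    truncNorm ρ (n + 1) (PowerSeries.X * p) = ρ * truncNorm ρ n p := by
  rw [truncNorm, Finset.sum_range_succ', truncNorm, Finset.mul_sum]
  simp only [PowerSeries.coeff_succ_X_mul, PowerSeries.coeff_zero_X_mul, norm_zero, zero_mul,
    add_zero]
  exact Finset.sum_congr rfl fun k _ => by ring

/-- Substitution of a series without constant term only involves finitely many coefficients. -/
theorem coeff_subst_eq_sum {q : ℂ⟦X⟧} (hq : PowerSeries.constantCoeff q = 0) (p : ℂ⟦X⟧)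
    {m N : ℕ} (h : m < N) :
    PowerSeries.coeff m (p.subst q) =
      ∑ k ∈ Finset.range N, PowerSeries.coeff k p * PowerSeries.coeff m (q ^ k) := by
  rw [PowerSeries.coeff_subst' (PowerSeries.HasSubst.of_constantCoeff_zero' hq)]
  simp only [smul_eq_mul]
  refine finsum_eq_sum_of_support_subset _ fun k hk => ?_
  by_contra hkN
  simp only [Finset.coe_range, Set.mem_Iio, not_lt] at hkN
  have hd : (PowerSeries.X : ℂ⟦X⟧) ^ k ∣ q ^ k :=
    pow_dvd_pow_of_dvd (PowerSeries.X_dvd_iff.mpr hq) k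
  exact hk (by simp [PowerSeries.X_pow_dvd_iff.mp hd m (by omega)])

theorem truncNorm_subst_le {ρ s : ℝ} (hρ : 0 ≤ ρ) {n : ℕ} (p : ℂ⟦X⟧) {q : ℂ⟦X⟧}
    (hq : PowerSeries.constantCoeff q = 0) (hs : truncNorm ρ n q ≤ s) :
    truncNorm ρ n (p.subst q) ≤ truncNorm s n p := by
  calc truncNorm ρ n (p.subst q)
      ≤ ∑ m ∈ Finset.range n, ∑ k ∈ Finset.range n,
          ‖PowerSeries.coeff k p‖ * (‖PowerSeries.coeff m (q ^ k)‖ * ρ ^ m) := by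
        refine Finset.sum_le_sum fun m hm => ?_
        rw [coeff_subst_eq_sum hq p (Finset.mem_range.mp hm)]
        refine (mul_le_mul_of_nonneg_right (norm_sum_le _ _) (by positivity)).trans ?_
        rw [Finset.sum_mul]
        exact Finset.sum_le_sum fun k _ => le_of_eq (by rw [norm_mul, mul_assoc])
    _ = ∑ k ∈ Finset.range n, ‖PowerSeries.coeff k p‖ * truncNorm ρ n (q ^ k) := by
        rw [Finset.sum_comm]
        simp only [truncNorm, Finset.mul_sum]
    _ ≤ truncNorm s n p := by
        refine Finset.sum_le_sum fun k _ => ?_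
        gcongr
        exact (truncNorm_pow_le hρ n q k).trans
          (pow_le_pow_left₀ (truncNorm_nonneg hρ n q) hs k)

/-! ### Convergent power series -/

/-- The power series `p` has a positive radius of convergence. -/
def IsConvergent (p : ℂ⟦X⟧) : Prop :=
  ∃ C r : ℝ, ∀ n : ℕ, ‖PowerSeries.coeff n p‖ ≤ C * r ^ n

theorem IsConvergent.of_truncNorm_le {p : ℂ⟦X⟧} {ρ C : ℝ} (hρ : 0 < ρ)
    (h : ∀ n, truncNorm ρ n p ≤ C) : IsConvergent p := by
  refine ⟨C, ρ⁻¹, fun n => ?_⟩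
  have h1 : ‖PowerSeries.coeff n p‖ * ρ ^ n ≤ truncNorm ρ (n + 1) p :=
    Finset.single_le_sum (f := fun k => ‖PowerSeries.coeff k p‖ * ρ ^ k)
      (fun _ _ => by positivity) (Finset.self_mem_range_succ n)
  rw [inv_pow, ← div_eq_mul_inv, le_div_iff₀ (by positivity)]
  exact h1.trans (h _)

theorem IsConvergent.exists_truncNorm_le {p : ℂ⟦X⟧} (h : IsConvergent p) :
    ∃ ρ C : ℝ, 0 < ρ ∧ 0 ≤ C ∧ ∀ n, truncNorm ρ n p ≤ C := by
  obtain ⟨C, r, h⟩ := h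
  have hC : 0 ≤ C := by simpa using (norm_nonneg _).trans (h 0)
  have hr : 0 < |r| + 1 := by positivity
  refine ⟨1 / 2 * (|r| + 1)⁻¹, C * 2, by positivity, by positivity, fun n => ?_⟩
  calc truncNorm (1 / 2 * (|r| + 1)⁻¹) n p
      ≤ ∑ k ∈ Finset.range n, C * (1 / 2 : ℝ) ^ k := by
        refine Finset.sum_le_sum fun k _ => ?_
        have h1 : ‖PowerSeries.coeff k p‖ ≤ C * (|r| + 1) ^ k := by
          refine (h k).trans (mul_le_mul_of_nonneg_left ?_ hC)
          calc r ^ k ≤ |r| ^ k := (le_abs_self _).trans (abs_pow r k).le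
            _ ≤ (|r| + 1) ^ k := by gcongr; linarith
        calc ‖PowerSeries.coeff k p‖ * (1 / 2 * (|r| + 1)⁻¹) ^ k
            ≤ C * (|r| + 1) ^ k * (1 / 2 * (|r| + 1)⁻¹) ^ k := by gcongr
          _ = C * (1 / 2) ^ k := by rw [mul_pow, inv_pow]; field_simp
    _ ≤ C * 2 := by
        rw [← Finset.mul_sum]
        gcongr
        exact sum_geometric_two_le n

theorem IsConvergent.neg {p : ℂ⟦X⟧} (hp : IsConvergent p) : IsConvergent (-p) := by
  obtain ⟨C, r, h⟩ := hp
  exact ⟨C, r, fun n => by simpa using h n⟩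

theorem IsConvergent.add {p q : ℂ⟦X⟧} (hp : IsConvergent p) (hq : IsConvergent q) :
    IsConvergent (p + q) := by
  obtain ⟨ρ, C, hρ, -, h⟩ := hp.exists_truncNorm_le
  obtain ⟨ρ', C', hρ', -, h'⟩ := hq.exists_truncNorm_le
  have hm : 0 < min ρ ρ' := lt_min hρ hρ'
  exact .of_truncNorm_le hm fun n => (truncNorm_add_le hm.le n p q).trans (add_le_add
    ((truncNorm_mono hm.le (min_le_left _ _) n p).trans (h n))
    ((truncNorm_mono hm.le (min_le_right _ _) n q).trans (h' n)))

/-- The norm of a convergent series without constant term becomes small on small discs. -/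
theorem IsConvergent.exists_truncNorm_le_of_constantCoeff {q : ℂ⟦X⟧} (hq : IsConvergent q)
    (h0 : PowerSeries.constantCoeff q = 0) {s : ℝ} (hs : 0 < s) :
    ∃ ρ : ℝ, 0 < ρ ∧ ∀ n, truncNorm ρ n q ≤ s := by
  obtain ⟨ρ, C, hρ, hC, h⟩ := hq.exists_truncNorm_le
  set t : ℝ := min 1 (s / (C + 1)) with ht
  have ht0 : 0 < t := lt_min one_pos (by positivity)
  refine ⟨t * ρ, by positivity, fun n => ?_⟩
  calc truncNorm (t * ρ) n q ≤ t * truncNorm ρ n q := by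
        rw [truncNorm, truncNorm, Finset.mul_sum]
        refine Finset.sum_le_sum fun k _ => ?_
        rcases k with _ | k
        · simp [h0]
        · have h1 : t ^ (k + 1) ≤ t := by
            rw [pow_succ]
            exact mul_le_of_le_one_left ht0.le (pow_le_one₀ ht0.le (min_le_left _ _))
          calc _ = t ^ (k + 1) * (‖PowerSeries.coeff (k + 1) q‖ * ρ ^ (k + 1)) := by ring
            _ ≤ _ := by gcongr
    _ ≤ s / (C + 1) * (C + 1) := by
        gcongr
        · exact truncNorm_nonneg hρ.le _ _
        · exact min_le_right _ _
        · exact (h n).trans (by linarith)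
    _ = s := by field_simp

theorem IsConvergent.subst {p q : ℂ⟦X⟧} (hp : IsConvergent p) (hq : IsConvergent q)
    (h0 : PowerSeries.constantCoeff q = 0) : IsConvergent (p.subst q) := by
  obtain ⟨s, C, hs, -, h⟩ := hp.exists_truncNorm_le
  obtain ⟨ρ, hρ, h'⟩ := hq.exists_truncNorm_le_of_constantCoeff h0 hs
  exact .of_truncNorm_le hρ fun n => (truncNorm_subst_le hρ.le p h0 (h' n)).trans (h n)

/-- The majorant method for an implicit equation `r = X * (1 + w)`, where `w` is an expression
in `r`: the coefficients of order `≤ n` of `r` only depend on those of order `< n` of `w`. -/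
theorem truncNorm_le_of_eq_X_mul {r w : ℂ⟦X⟧} (hr : r = PowerSeries.X * (1 + w)) {ρ s K : ℝ}
    (hρ : 0 ≤ ρ) (hs : 0 ≤ s) (hw : ∀ n, truncNorm ρ n r ≤ s → truncNorm ρ n w ≤ K)
    (hK : ρ * (1 + K) ≤ s) (n : ℕ) : truncNorm ρ n r ≤ s := by
  induction n with
  | zero => simpa [truncNorm] using hs
  | succ n ih =>
    rw [hr, truncNorm_X_mul]
    refine le_trans ?_ hK
    gcongr
    exact (truncNorm_add_le hρ n _ _).trans (add_le_add (truncNorm_one_le ρ n) (hw n ih))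

/-! ### Analytic diffeos form a group -/

theorem isConvergent_recip {f : FormalDiffeo} (hf : f.IsAnalytic) : IsConvergent f.recip := by
  obtain ⟨ρ, C, hρ, hC, h⟩ := IsConvergent.exists_truncNorm_le (p := f.tail) hf
  have hm : 0 < min ρ (1 + C)⁻¹ := lt_min hρ (by positivity)
  have hr : f.recip = PowerSeries.X * (1 + -(f.tail * f.recip)) := by
    linear_combination f.recip_mul
  refine .of_truncNorm_le hm (truncNorm_le_of_eq_X_mul hr hm.le zero_le_one (K := C) ?_ ?_)
  · intro n hn
    rw [truncNorm_neg]
    refine (truncNorm_mul_le hm.le n _ _).trans ?_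
    calc _ ≤ C * 1 := mul_le_mul ((truncNorm_mono hm.le (min_le_left _ _) n _).trans (h n)) hn
          (truncNorm_nonneg hm.le n _) hC
      _ = C := mul_one C
  · calc min ρ (1 + C)⁻¹ * (1 + C) ≤ (1 + C)⁻¹ * (1 + C) := by gcongr; exact min_le_right _ _
      _ = 1 := inv_mul_cancel₀ (by positivity)

theorem IsAnalytic.mul {f g : FormalDiffeo} (hf : f.IsAnalytic) (hg : g.IsAnalytic) :
    (f * g).IsAnalytic :=
  IsConvergent.add (p := g.tail) hg
    (IsConvergent.subst (p := f.tail) hf (isConvergent_recip hg) g.constantCoeff_recip)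

/-- With `r = 1 / f⁻¹(z)`, the equation `f (f⁻¹ z) = z` reads `r = X * (1 + r * tail_f(r))`, and
it bounds the coefficients of `r`. -/
theorem IsAnalytic.inv {f : FormalDiffeo} (hf : f.IsAnalytic) : f⁻¹.IsAnalytic := by
  have ht : f⁻¹.tail = -f.tail.subst f⁻¹.recip := by
    have h := congrArg tail (mul_inv_cancel f)
    rw [mul_tail, one_tail] at h
    exact eq_neg_of_add_eq_zero_left h
  have hr : f⁻¹.recip = PowerSeries.X * (1 + f⁻¹.recip * f.tail.subst f⁻¹.recip) := by
    have h := f⁻¹.recip_mul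
    rw [ht] at h
    linear_combination h
  obtain ⟨s, C, hs, hC, h⟩ := IsConvergent.exists_truncNorm_le (p := f.tail) hf
  have hρ : 0 < s / (1 + s * C) := by positivity
  have hb := truncNorm_le_of_eq_X_mul hr hρ.le hs.le (K := s * C)
    (fun n hn => (truncNorm_mul_le hρ.le n _ _).trans (mul_le_mul hn
      ((truncNorm_subst_le hρ.le _ f⁻¹.constantCoeff_recip hn).trans (h n))
      (truncNorm_nonneg hρ.le n _) hs.le))
    (le_of_eq (by field_simp))
  have hc : IsConvergent f⁻¹.recip := .of_truncNorm_le hρ hb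
  have := (IsConvergent.subst (p := f.tail) hf hc f⁻¹.constantCoeff_recip).neg
  rwa [← ht] at this

theorem isAnalytic_one : (1 : FormalDiffeo).IsAnalytic := ⟨0, 0, fun n => by simp [one_tail]⟩

theorem IsAnalytic.zpow {f : FormalDiffeo} (hf : f.IsAnalytic) (n : ℤ) : (f ^ n).IsAnalytic := by
  have hN (m : ℕ) : (f ^ m).IsAnalytic := by
    induction m with
    | zero => simpa using isAnalytic_one
    | succ m ih => rw [pow_succ]; exact ih.mul hf
  obtain ⟨m, rfl | rfl⟩ := n.eq_nat_or_neg
  · simpa using hN m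
  · simpa using (hN m).inv

/-! ### The first two coefficients -/

theorem shift_mul (f g : FormalDiffeo) : (f * g).shift = f.shift + g.shift := by
  have h : PowerSeries.coeff 0 (f.tail.subst g.recip) = f.shift := by
    rw [coeff_subst_eq_sum g.constantCoeff_recip f.tail one_pos]
    simp [shift]
  rw [PowerSeries.coeff_zero_eq_constantCoeff_apply] at h
  rw [shift, mul_tail, map_add, h, add_comm]
  rfl

/-- `shift` as a homomorphism to the additive group `ℂ`. -/
noncomputable def shiftHom : FormalDiffeo →* Multiplicative ℂ :=
  MonoidHom.mk' (fun f => Multiplicative.ofAdd f.shift) fun f g => by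
    rw [shift_mul, ofAdd_add]

theorem shift_inv (f : FormalDiffeo) : f⁻¹.shift = -f.shift :=
  congrArg Multiplicative.toAdd (map_inv shiftHom f)

theorem shift_zpow (f : FormalDiffeo) (n : ℤ) : (f ^ n).shift = n * f.shift := by
  simpa [shiftHom] using congrArg Multiplicative.toAdd (map_zpow shiftHom f n)

/-- The coefficient of `z⁻¹`, the only obstruction to the existence of a formal iterator, as a
homomorphism to the additive group `ℂ`. -/
noncomputable def residueHom : FormalDiffeo →* Multiplicative ℂ :=
  MonoidHom.mk' (fun f => Multiplicative.ofAdd (PowerSeries.coeff 1 f.tail)) fun f g => by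
    rw [← ofAdd_add, mul_tail, map_add,
      coeff_subst_eq_sum g.constantCoeff_recip f.tail (Nat.lt_succ_self 1), Finset.sum_range_succ,
      Finset.sum_range_one, pow_zero, pow_one, coeff_one_recip, PowerSeries.coeff_one,
      if_neg one_ne_zero, mul_zero, mul_one, zero_add, add_comm]

/-! ### The linearised Abel equation -/

theorem coeff_succ_recip_pow (f : FormalDiffeo) (n : ℕ) :
    PowerSeries.coeff (n + 1) (f.recip ^ n) = -n * f.shift := by
  have h0 : PowerSeries.constantCoeff (1 + PowerSeries.X * f.tail : ℂ⟦X⟧)⁻¹ = 1 := by simp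
  have h1 : PowerSeries.coeff 1 (1 + PowerSeries.X * f.tail : ℂ⟦X⟧)⁻¹ = -f.shift := by
    have h := congrArg (PowerSeries.coeff 1)
      (PowerSeries.inv_mul_cancel (1 + PowerSeries.X * f.tail : ℂ⟦X⟧) (by simp))
    rw [mul_add, mul_one, map_add, mul_left_comm, show (1 : ℕ) = 0 + 1 from rfl,
      PowerSeries.coeff_succ_X_mul, PowerSeries.coeff_zero_eq_constantCoeff_apply, map_mul,
      h0, PowerSeries.coeff_one] at h
    simp only [one_mul] at h
    exact eq_neg_of_add_eq_zero_left (by simpa [shift] using h)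
  rw [recip, mul_pow, add_comm n 1, PowerSeries.coeff_X_pow_mul, PowerSeries.coeff_one_pow, h0, h1]
  simp

/-- The operator `Φ ↦ Φ ∘ f - Φ` is triangular: it raises the order of `Xⁿ` by one, with leading
coefficient `-n * f.shift`. -/
theorem coeff_succ_subst_recip_sub (f : FormalDiffeo) (p : ℂ⟦X⟧) (n : ℕ) :
    PowerSeries.coeff (n + 1) (p.subst f.recip - p) =
      ∑ k ∈ Finset.range n, PowerSeries.coeff k p * PowerSeries.coeff (n + 1) (f.recip ^ k)
        + PowerSeries.coeff n p * (-n * f.shift) := by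
  have h1 : PowerSeries.coeff (n + 1) (f.recip ^ (n + 1)) = 1 := by
    have := PowerSeries.coeff_X_pow_mul ((1 + PowerSeries.X * f.tail : ℂ⟦X⟧)⁻¹ ^ (n + 1)) (n + 1) 0
    rw [zero_add] at this
    rw [recip, mul_pow, this]
    simp
  rw [map_sub, coeff_subst_eq_sum f.constantCoeff_recip p (Nat.lt_succ_self (n + 1)),
    Finset.sum_range_succ, Finset.sum_range_succ, coeff_succ_recip_pow, h1]
  ring

/-- Two values of a power series differ by a multiple of the difference of the arguments. -/
theorem X_pow_dvd_subst_sub_subst {a b : ℂ⟦X⟧} (ha : PowerSeries.constantCoeff a = 0)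
    (hb : PowerSeries.constantCoeff b = 0) {N : ℕ} (h : PowerSeries.X ^ N ∣ a - b) (p : ℂ⟦X⟧) :
    PowerSeries.X ^ N ∣ p.subst a - p.subst b := by
  rw [PowerSeries.X_pow_dvd_iff]
  intro m hm
  rw [map_sub, coeff_subst_eq_sum ha p hm, coeff_subst_eq_sum hb p hm, ← Finset.sum_sub_distrib]
  refine Finset.sum_eq_zero fun k _ => ?_
  rw [← mul_sub, ← map_sub,
    PowerSeries.X_pow_dvd_iff.mp (h.trans (sub_dvd_pow_sub_pow a b k)) m hm, mul_zero]

/-- The centraliser of a diffeo with non-zero shift contains no `g ≠ 1` with zero shift: at a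
leading term `c z⁻ⁿ` of `g - z`, the commutator would have the term `-n c f.shift z⁻ⁿ⁻¹`. -/
theorem eq_one_of_commute {f g : FormalDiffeo} (hf : f.shift ≠ 0) (hg : g.shift = 0)
    (h : g * f = f * g) : g = 1 := by
  have ht : g.tail.subst f.recip - g.tail = f.tail.subst g.recip - f.tail.subst PowerSeries.X := by
    have h := congrArg tail h
    rw [mul_tail, mul_tail] at h
    rw [PowerSeries.X_subst]
    linear_combination h
  ext n
  rw [one_tail, map_zero]
  induction n using Nat.strong_induction_on with
  | _ n ih =>
    rcases Nat.eq_zero_or_pos n with rfl | hn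
    · simpa [shift] using hg
    have hd : PowerSeries.X ^ n ∣ g.tail := PowerSeries.X_pow_dvd_iff.mpr ih
    have hX : PowerSeries.X ^ (n + 2) ∣ g.recip - PowerSeries.X := by
      have h1 : g.recip - PowerSeries.X =
          -(g.tail * (PowerSeries.X * g.recip)) := by linear_combination g.recip_mul
      rw [h1, pow_add, dvd_neg, pow_two]
      exact mul_dvd_mul hd (mul_dvd_mul_left _ (PowerSeries.X_dvd_iff.mpr g.constantCoeff_recip))
    have h2 := PowerSeries.X_pow_dvd_iff.mp
      (X_pow_dvd_subst_sub_subst g.constantCoeff_recip (by simp) hX f.tail) (n + 1) (by omega)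
    rw [← ht, coeff_succ_subst_recip_sub, Finset.sum_eq_zero, zero_add] at h2
    · have hn' : (n : ℂ) ≠ 0 := Nat.cast_ne_zero.mpr hn.ne'
      simpa [hf, hn'] using h2
    · intro k hk
      rw [ih k (Finset.mem_range.mp hk), zero_mul]

/-- The coefficients of the solution `Φ` of `Φ ∘ f - Φ = q` with zero constant term, for
`f.shift = 1`, obtained by recursion. At `n = 0` the division by zero gives the required
value `0`. -/
noncomputable def abelCoeff (f : FormalDiffeo) (q : ℂ⟦X⟧) : ℕ → ℂ
  | n => (∑ k : Fin n, abelCoeff f q k * PowerSeries.coeff (n + 1) (f.recip ^ (k : ℕ))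
      - PowerSeries.coeff (n + 1) q) / n

theorem exists_subst_recip_sub_eq {f : FormalDiffeo} (hf : f.shift = 1) {q : ℂ⟦X⟧}
    (h0 : PowerSeries.coeff 0 q = 0) (h1 : PowerSeries.coeff 1 q = 0) :
    ∃ p : ℂ⟦X⟧, PowerSeries.constantCoeff p = 0 ∧ p.subst f.recip - p = q := by
  refine ⟨PowerSeries.mk (abelCoeff f q), ?_, ?_⟩
  · rw [← PowerSeries.coeff_zero_eq_constantCoeff_apply, PowerSeries.coeff_mk, abelCoeff]
    simp
  · ext n
    rcases n with _ | n
    · rw [h0, map_sub, coeff_subst_eq_sum f.constantCoeff_recip _ one_pos]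
      simp
    · rw [coeff_succ_subst_recip_sub, hf, PowerSeries.coeff_mk]
      simp only [PowerSeries.coeff_mk]
      rcases Nat.eq_zero_or_pos n with rfl | hn
      · simp [h1]
      · have hn' : (n : ℂ) ≠ 0 := Nat.cast_ne_zero.mpr hn.ne'
        rw [abelCoeff, Fin.sum_univ_eq_sum_range
          (fun k => abelCoeff f q k * PowerSeries.coeff (n + 1) (f.recip ^ k)) n]
        field_simp
        ring

/-! ### Formal iterators -/

theorem shift_l : l.shift = 1 := by simp [shift, l]

theorem l_mul_tail (f : FormalDiffeo) : (l * f).tail = f.tail + 1 := by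
  have e : PowerSeries.subst f.recip (1 : ℂ⟦X⟧) = (1 : ℂ⟦X⟧) := by
    rw [← PowerSeries.coe_substAlgHom f.hasSubst_recip, map_one]
  rw [mul_tail, l, e]

theorem exists_isIterator {f : FormalDiffeo} (hf : f.shift = 1)
    (h1 : PowerSeries.coeff 1 f.tail = 0) : ∃ F : FormalDiffeo, f.IsIterator F := by
  obtain ⟨p, hp0, hp⟩ := exists_subst_recip_sub_eq hf (q := 1 - f.tail)
    (by rw [map_sub, sub_eq_zero]; simpa [shift] using hf.symm)
    (by simp [h1, PowerSeries.coeff_one])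
  refine ⟨⟨p⟩, ?_, hp0⟩
  ext1
  rw [mul_tail, l_mul_tail]
  linear_combination hp

theorem IsIterator.eq {f F F' : FormalDiffeo} (h : f.IsIterator F) (h' : f.IsIterator F') :
    F = F' := by
  refine mul_inv_eq_one.mp (eq_one_of_commute (f := l) (by simp [shift_l]) ?_ ?_)
  · rw [shift_mul, shift_inv, h.2, h'.2, neg_zero, add_zero]
  · rw [← mul_assoc, ← h.1, mul_assoc, mul_assoc, mul_right_inj, inv_mul_eq_iff_eq_mul,
      ← mul_assoc, h'.1, mul_inv_cancel_right]

theorem existsUnique_isIterator {f : FormalDiffeo} (hf : f.shift = 1)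
    (h1 : PowerSeries.coeff 1 f.tail = 0) : ∃! F : FormalDiffeo, f.IsIterator F :=
  (exists_isIterator hf h1).elim fun F hF => ⟨F, hF, fun _ h => h.eq hF⟩

/-! ### The mean of a diffeo and the identity -/

/-- The diffeo `(z + f(z)) / 2`. -/
noncomputable def average (f : FormalDiffeo) : FormalDiffeo := ⟨(2⁻¹ : ℂ) • f.tail⟩

theorem IsAnalytic.average {f : FormalDiffeo} (hf : f.IsAnalytic) : (average f).IsAnalytic := by
  obtain ⟨C, r, h⟩ := hf
  refine ⟨2⁻¹ * C, r, fun n => ?_⟩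
  rw [FormalDiffeo.average, map_smul, norm_smul, mul_assoc]
  simpa using h n

theorem shift_average (f : FormalDiffeo) : (average f).shift = 2⁻¹ * f.shift := by
  simp [average, shift]

/-- If `p ∘ k` is the identity, then `((id + p) / 2) ∘ k = (k + id) / 2`. -/
theorem average_mul_of_mul_eq_one {p k : FormalDiffeo} (h : p * k = 1) :
    average p * k = average k := by
  have h := congrArg tail h
  rw [mul_tail, one_tail] at h
  ext1
  rw [mul_tail, average, average, PowerSeries.subst_smul k.hasSubst_recip,
    ← sub_eq_zero, show p.tail.subst k.recip = -k.tail from eq_neg_of_add_eq_zero_right h]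
  module

/-! ### Involutive symmetries -/

/-- An involutive endomorphism of the group of diffeos that is compatible with convergence, with
the normalisation `z + o(1)` and with the additive mean. -/
structure IsSymmetry (α : FormalDiffeo →* FormalDiffeo) : Prop where
  map_map : ∀ f, α (α f) = f
  isAnalytic : ∀ f, f.IsAnalytic → (α f).IsAnalytic
  shift_eq_zero : ∀ f, f.shift = 0 → (α f).shift = 0
  map_average : ∀ f, α (average f) = average (α f)

namespace IsSymmetry

variable {α : FormalDiffeo →* FormalDiffeo}

theorem map_average_mul (hα : IsSymmetry α) {k : FormalDiffeo} (hk : α k * k = 1) :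
    α (average k) * k = average k := by
  rw [hα.map_average, average_mul_of_mul_eq_one hk]

/-- If `k` conjugates `α f` to `f⁻¹` and `α k = k⁻¹`, then the mean of `id` and `k⁻¹` conjugates
`f` to a diffeo inverted by `α`. -/
theorem map_conj_average (hα : IsSymmetry α) {f k : FormalDiffeo} (hk : α k * k = 1)
    (h : k * α f * k⁻¹ = f⁻¹) :
    α (average k⁻¹ * f * (average k⁻¹)⁻¹) = (average k⁻¹ * f * (average k⁻¹)⁻¹)⁻¹ := by
  have hk' : α k⁻¹ * k⁻¹ = 1 := by
    rw [map_inv, eq_inv_of_mul_eq_one_left hk, inv_inv, mul_inv_cancel]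
  have h1 : α (average k⁻¹) = average k⁻¹ * k := eq_mul_of_mul_inv_eq (hα.map_average_mul hk')
  rw [map_mul, map_mul, map_inv, h1, mul_inv_rev, mul_inv_rev, mul_inv_rev, inv_inv, ← h]
  group

theorem exists_anConj_mul (hα : IsSymmetry α) {f₁ f₂ : FormalDiffeo} (a₁ : f₁.IsAnalytic)
    (a₂ : f₂.IsAnalytic) (h₁ : α f₁ = f₁⁻¹) (h₂ : α f₂ = f₂⁻¹) :
    ∃ f₀ : FormalDiffeo, f₀.IsAnalytic ∧ α f₀ = f₀⁻¹ ∧ (f₁ * f₂).AnConj f₀ := by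
  have a := a₁.inv.average
  refine ⟨_, (a.mul (a₁.mul a₂)).mul a.inv,
    hα.map_conj_average (f := f₁ * f₂) (k := f₁) ?_ ?_, _, a, rfl⟩
  · rw [h₁, inv_mul_cancel]
  · rw [map_mul, h₁, h₂]
    group

theorem exists_anConj_mul_and_mul_inv (hα : IsSymmetry α) {f₁ f₂ : FormalDiffeo} (a₁ : f₁.IsAnalytic)
    (a₂ : f₂.IsAnalytic) (h₁ : α f₁ = f₁⁻¹) (h₂ : α f₂ = f₂⁻¹) :
    (∃ f₀ : FormalDiffeo, f₀.IsAnalytic ∧ α f₀ = f₀⁻¹ ∧ (f₁ * f₂).AnConj f₀) ∧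
    (∃ f₀ : FormalDiffeo, f₀.IsAnalytic ∧ α f₀ = f₀⁻¹ ∧ (f₁ * f₂⁻¹).AnConj f₀) :=
  ⟨hα.exists_anConj_mul a₁ a₂ h₁ h₂, hα.exists_anConj_mul a₁ a₂.inv h₁ (by rw [map_inv, h₂])⟩

/-- A normalised conjugacy `k` from `α f` to `f⁻¹` satisfies `α k = k⁻¹`, because `k * α k`
commutes with `f`. -/
theorem map_mul_self_eq_one (hα : IsSymmetry α) {f k : FormalDiffeo} (hf : f.shift ≠ 0)
    (hk : k.shift = 0) (h : k * α f * k⁻¹ = f⁻¹) : α k * k = 1 := by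
  have h1 : k * α f = f⁻¹ * k := mul_inv_eq_iff_eq_mul.mp h
  have h2 : α k * f = (α f)⁻¹ * α k := by
    have := congrArg α h1
    rwa [map_mul, map_mul, hα.map_map, map_inv] at this
  have h3 : (k * α k) * f = f * (k * α k) := by
    have h4 : k * (α f)⁻¹ = f * k := by
      rw [mul_inv_eq_iff_eq_mul, mul_assoc, h1, mul_inv_cancel_left]
    rw [mul_assoc, h2, ← mul_assoc, h4, mul_assoc]
  have h5 := eq_one_of_commute hf (by rw [shift_mul, hk, hα.shift_eq_zero k hk, add_zero]) h3
  exact mul_eq_one_comm.mp h5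

theorem exists_conj_normalised (hα : IsSymmetry α) {f : FormalDiffeo} (hf : f.shift ≠ 0)
    (h : NormAnConj (α f) f⁻¹) :
    ∃ h : FormalDiffeo, h.IsAnalytic ∧ h.shift = 0 ∧ α (h * f * h⁻¹) = (h * f * h⁻¹)⁻¹ := by
  obtain ⟨k, ak, hk, h⟩ := h
  exact ⟨average k⁻¹, ak.inv.average, by rw [shift_average, shift_inv, hk, neg_zero, mul_zero],
    hα.map_conj_average (hα.map_mul_self_eq_one hf hk h) h⟩

/-- The factor `f ^ n * h⁻¹ * α h` is inverted by `α`: `h⁻¹ * α h` is inverted by `α` and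
conjugates `α f` to `f⁻¹`. -/
theorem map_factor (hα : IsSymmetry α) {f h : FormalDiffeo}
    (hf : α (h * f * h⁻¹) = (h * f * h⁻¹)⁻¹) (n : ℤ) :
    α (f ^ n * h⁻¹ * α h) = (f ^ n * h⁻¹ * α h)⁻¹ := by
  have h1 : α f = (h⁻¹ * α h)⁻¹ * f⁻¹ * (h⁻¹ * α h)⁻¹⁻¹ := by
    have h2 : α h * α f * (α h)⁻¹ = (h * f * h⁻¹)⁻¹ := by rw [← hf, map_mul, map_mul, map_inv]
    have h3 : α f = (α h)⁻¹ * (h * f * h⁻¹)⁻¹ * α h := by rw [← h2]; group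
    rw [h3]
    group
  rw [map_mul, map_mul, map_zpow, map_inv, hα.map_map, h1, conj_zpow, inv_zpow]
  group

theorem isAnalytic_factor (hα : IsSymmetry α) {f h : FormalDiffeo} (hf : f.IsAnalytic)
    (hh : h.IsAnalytic) (n : ℤ) : (f ^ n * h⁻¹ * α h).IsAnalytic :=
  ((hf.zpow n).mul hh.inv).mul (hα.isAnalytic h hh)

/-- If `h` conjugates `f` to a diffeo inverted by `α`, then `F * h⁻¹`, an iterator of that diffeo,
is fixed by `α`, so that `h⁻¹ * α h = F⁻¹ * α F`. -/
theorem factor_eq (hα : IsSymmetry α) (hl : α l = l⁻¹) {f h F : FormalDiffeo} (hh : h.shift = 0)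
    (hf : α (h * f * h⁻¹) = (h * f * h⁻¹)⁻¹) (hF : f.IsIterator F) (n : ℤ) :
    f ^ n * h⁻¹ * α h = F⁻¹ * l ^ n * α F ∧ f ^ n * h⁻¹ * α h = f ^ n * F⁻¹ * α F := by
  have hg : IsIterator (h * f * h⁻¹) (F * h⁻¹) := by
    constructor
    · rw [← mul_assoc l, ← hF.1]
      group
    · rw [shift_mul, shift_inv, hF.2, hh, neg_zero, add_zero]
  have hg' : IsIterator (h * f * h⁻¹) (α (F * h⁻¹)) := by
    refine ⟨?_, hα.shift_eq_zero _ hg.2⟩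
    have h1 := congrArg α hg.1
    rw [map_mul α (F * h⁻¹), map_mul α l, hf, hl, mul_inv_eq_iff_eq_mul, mul_assoc,
      eq_inv_mul_iff_mul_eq] at h1
    exact h1.symm
  have h2 := hg.eq hg'
  rw [map_mul, map_inv] at h2
  have h3 : α h = h * F⁻¹ * α F := by
    rw [eq_mul_inv_iff_mul_eq] at h2
    rw [← h2]
    group
  have h4 : f ^ n = F⁻¹ * l ^ n * F := by
    have h5 : f = F⁻¹ * l * F⁻¹⁻¹ := by rw [inv_inv, mul_assoc, ← hF.1, inv_mul_cancel_left]
    conv_lhs => rw [h5, conj_zpow, inv_inv]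
  have h6 : f ^ n * h⁻¹ * α h = f ^ n * F⁻¹ * α F := by
    rw [h3]
    group
  refine ⟨?_, h6⟩
  rw [h6, h4]
  group

end IsSymmetry

theorem eq_factor_mul_inv_factor (f h k : FormalDiffeo) {n₁ n₂ : ℤ} (hn : n₁ - n₂ = 1) :
    f = (f ^ n₁ * h⁻¹ * k) * (f ^ n₂ * h⁻¹ * k)⁻¹ := by
  have h1 : f ^ n₁ * (f ^ n₂)⁻¹ = f := by
    rw [← zpow_neg, ← zpow_add, ← sub_eq_add_neg, hn, zpow_one]
  nth_rewrite 1 [← h1]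
  group

/-! ### Reflection and complex conjugation -/

theorem rescale_neg_one_subst {q : ℂ⟦X⟧} (hq : PowerSeries.constantCoeff q = 0) (p : ℂ⟦X⟧) :
    PowerSeries.rescale (-1) (p.subst q) =
      (PowerSeries.rescale (-1) p).subst (-PowerSeries.rescale (-1) q) := by
  have hX : PowerSeries.HasSubst ((-1 : ℂ) • (PowerSeries.X : ℂ⟦X⟧)) :=
    PowerSeries.HasSubst.smul_X' _
  have hq' : PowerSeries.HasSubst (-PowerSeries.rescale (-1) q) :=
    PowerSeries.HasSubst.of_constantCoeff_zero' (by
      rw [map_neg, ← PowerSeries.coeff_zero_eq_constantCoeff_apply, PowerSeries.coeff_rescale,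
        PowerSeries.coeff_zero_eq_constantCoeff_apply, hq, mul_zero, neg_zero])
  rw [PowerSeries.rescale_eq_subst (-1) (p.subst q), PowerSeries.rescale_eq_subst (-1) p,
    PowerSeries.subst_comp_subst_apply (PowerSeries.HasSubst.of_constantCoeff_zero' hq) hX,
    PowerSeries.subst_comp_subst_apply hX hq', PowerSeries.subst_smul hq',
    PowerSeries.subst_X hq', ← PowerSeries.rescale_eq_subst, neg_one_smul, neg_neg]

theorem recip_eq_of_mul_eq {f : FormalDiffeo} {r : ℂ⟦X⟧}
    (h : r * (1 + PowerSeries.X * f.tail) = PowerSeries.X) : f.recip = r :=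
  mul_right_cancel₀ f.one_add_ne_zero (f.recip_mul.trans h.symm)

theorem recip_check (f : FormalDiffeo) :
    (check f).recip = -PowerSeries.rescale (-1) f.recip := by
  apply recip_eq_of_mul_eq
  have h := congrArg (PowerSeries.rescale (-1 : ℂ)) f.recip_mul
  rw [map_mul, map_add, map_one, map_mul, PowerSeries.rescale_neg_one_X] at h
  rw [check]
  linear_combination -h

theorem recip_bar (f : FormalDiffeo) :
    (bar f).recip = PowerSeries.map (starRingEnd ℂ) f.recip := by
  apply recip_eq_of_mul_eq
  have h := congrArg (PowerSeries.map (starRingEnd ℂ)) f.recip_mul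
  rwa [map_mul, map_add, map_one, map_mul, PowerSeries.map_X] at h

/-- `f ↦ σ ∘ f ∘ σ` as a group endomorphism. -/
noncomputable def checkHom : FormalDiffeo →* FormalDiffeo :=
  MonoidHom.mk' check fun f g => by
    ext1
    rw [mul_tail, recip_check, check, mul_tail, map_add,
      rescale_neg_one_subst g.constantCoeff_recip, ← recip_check, neg_add,
      ← PowerSeries.coe_substAlgHom (check g).hasSubst_recip]
    exact congrArg ((check g).tail + ·) (map_neg _ _).symm

/-- `f ↦ bar f` as a group endomorphism. -/
noncomputable def barHom : FormalDiffeo →* FormalDiffeo :=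
  MonoidHom.mk' bar fun f g => by
    ext1
    rw [mul_tail, recip_bar, bar, mul_tail, map_add]
    exact congrArg ((bar g).tail + ·) (PowerSeries.map_subst g.hasSubst_recip f.tail)

theorem coeff_check (f : FormalDiffeo) (n : ℕ) :
    PowerSeries.coeff n (check f).tail = -((-1) ^ n * PowerSeries.coeff n f.tail) := by
  simp [check]

theorem coeff_bar (f : FormalDiffeo) (n : ℕ) :
    PowerSeries.coeff n (bar f).tail = starRingEnd ℂ (PowerSeries.coeff n f.tail) := by
  simp [bar]

theorem shift_check (f : FormalDiffeo) : (check f).shift = -f.shift := by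
  simpa [shift] using coeff_check f 0

theorem shift_bar (f : FormalDiffeo) : (bar f).shift = starRingEnd ℂ f.shift := by
  simpa [shift] using coeff_bar f 0

theorem isSymmetry_checkHom : IsSymmetry checkHom where
  map_map f := by
    ext n
    change PowerSeries.coeff n (check (check f)).tail = _
    rw [coeff_check, coeff_check]
    rcases neg_one_pow_eq_or ℂ n with h | h <;> simp [h]
  isAnalytic := fun f ⟨C, r, h⟩ => ⟨C, r, fun n => by
    change ‖PowerSeries.coeff n (check f).tail‖ ≤ _
    rw [coeff_check]
    simpa using h n⟩
  shift_eq_zero f h := by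
    change (check f).shift = 0
    rw [shift_check, h, neg_zero]
  map_average f := by
    ext n
    change PowerSeries.coeff n (check (average f)).tail
      = PowerSeries.coeff n (average (check f)).tail
    rw [coeff_check, average, average, map_smul, map_smul, coeff_check, smul_eq_mul, smul_eq_mul]
    ring

theorem isSymmetry_barHom : IsSymmetry barHom where
  map_map f := by
    ext n
    change PowerSeries.coeff n (bar (bar f)).tail = _
    rw [coeff_bar, coeff_bar, Complex.conj_conj]
  isAnalytic := fun f ⟨C, r, h⟩ => ⟨C, r, fun n => by
    change ‖PowerSeries.coeff n (bar f).tail‖ ≤ _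
    rw [coeff_bar]
    simpa using h n⟩
  shift_eq_zero f h := by
    change (bar f).shift = 0
    rw [shift_bar, h, map_zero]
  map_average f := by
    ext n
    change PowerSeries.coeff n (bar (average f)).tail = PowerSeries.coeff n (average (bar f)).tail
    simp [average, coeff_bar, Complex.conj_ofNat]

theorem bar_check (f : FormalDiffeo) : bar (check f) = check (bar f) := by
  ext n
  rw [coeff_bar, coeff_check, coeff_check, coeff_bar]
  simp

theorem isSymmetry_checkHom_comp_barHom : IsSymmetry (checkHom.comp barHom) where
  map_map f := by
    change check (bar (check (bar f))) = f
    rw [bar_check]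
    exact (isSymmetry_checkHom.map_map _).trans (isSymmetry_barHom.map_map f)
  isAnalytic f h := isSymmetry_checkHom.isAnalytic _ (isSymmetry_barHom.isAnalytic f h)
  shift_eq_zero f h := isSymmetry_checkHom.shift_eq_zero _ (isSymmetry_barHom.shift_eq_zero f h)
  map_average f :=
    (congrArg checkHom (isSymmetry_barHom.map_average f)).trans (isSymmetry_checkHom.map_average _)

theorem bar_l : bar l = l := by
  ext1
  simp [bar, l]

theorem check_l : check l = l⁻¹ := by
  rw [eq_inv_iff_mul_eq_one, ← mul_eq_one_comm]
  ext1
  rw [l_mul_tail, check, l, map_one, neg_add_cancel, one_tail]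

theorem shift_reflexiveFactor {f : FormalDiffeo} (hf : f.shift = 1) (h : FormalDiffeo) (n : ℤ) :
    (f.reflexiveFactor h n).shift = n - 2 * h.shift := by
  rw [reflexiveFactor, shift_mul, shift_mul, shift_zpow, shift_inv, shift_check, hf]
  ring

theorem shift_counitaryFactor {f : FormalDiffeo} (hf : f.shift = 1) (h : FormalDiffeo) (n : ℤ) :
    (f.counitaryFactor h n).shift = n - 2 * (h.shift.re : ℂ) := by
  have h1 : h.shift + starRingEnd ℂ h.shift = 2 * (h.shift.re : ℂ) := by
    rw [Complex.add_conj]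
    push_cast
    ring
  rw [counitaryFactor, shift_mul, shift_mul, shift_zpow, shift_inv, shift_check, shift_bar, hf]
  linear_combination -h1

theorem IsWeaklyReflexive.coeff_one_eq_zero {f : FormalDiffeo} (hf : f.IsWeaklyReflexive) :
    PowerSeries.coeff 1 f.tail = 0 := by
  obtain ⟨k, -, -, h⟩ := hf
  have h1 := congrArg residueHom h
  rw [map_mul, map_mul, map_inv, map_inv, mul_right_comm, mul_inv_cancel, one_mul] at h1
  have h2 : PowerSeries.coeff 1 (check f).tail = -PowerSeries.coeff 1 f.tail := h1
  rw [coeff_check, pow_one, neg_one_mul, neg_neg] at h2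
  exact self_eq_neg.mp h2

end FormalDiffeo

theorem mainTheorem7 :
    -- products and quotients of two reflexive, unitary, counitary diffeos
    (∀ f₁ f₂ : FormalDiffeo, f₁.IsAnalytic → f₂.IsAnalytic →
      (f₁.IsReflexive → f₂.IsReflexive →
        (∃ f₀ : FormalDiffeo, f₀.IsAnalytic ∧ f₀.IsReflexive ∧ (f₁ * f₂).AnConj f₀) ∧
        (∃ f₀ : FormalDiffeo, f₀.IsAnalytic ∧ f₀.IsReflexive ∧ (f₁ * f₂⁻¹).AnConj f₀)) ∧
      (f₁.IsUnitary → f₂.IsUnitary →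
        (∃ f₀ : FormalDiffeo, f₀.IsAnalytic ∧ f₀.IsUnitary ∧ (f₁ * f₂).AnConj f₀) ∧
        (∃ f₀ : FormalDiffeo, f₀.IsAnalytic ∧ f₀.IsUnitary ∧ (f₁ * f₂⁻¹).AnConj f₀)) ∧
      (f₁.IsCounitary → f₂.IsCounitary →
        (∃ f₀ : FormalDiffeo, f₀.IsAnalytic ∧ f₀.IsCounitary ∧ (f₁ * f₂).AnConj f₀) ∧
        (∃ f₀ : FormalDiffeo, f₀.IsAnalytic ∧ f₀.IsCounitary ∧ (f₁ * f₂⁻¹).AnConj f₀))) ∧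
    ∀ f : FormalDiffeo, f.IsAnalytic → f.shift = 1 →
      -- bifactorisation, reflexive case
      (f.IsWeaklyReflexive →
        (∃ h : FormalDiffeo, h.IsAnalytic ∧ h.shift = 0 ∧ (h * f * h⁻¹).IsReflexive) ∧
        (∃! F : FormalDiffeo, f.IsIterator F) ∧
        ∀ h : FormalDiffeo, h.IsAnalytic → h.shift = 0 → (h * f * h⁻¹).IsReflexive →
          ∀ n₁ n₂ : ℤ, n₁ - n₂ = 1 →
            ∀ f₁ f₂ : FormalDiffeo,
              f₁ = f.reflexiveFactor h n₁ → f₂ = f.reflexiveFactor h n₂ →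
              (f₁.IsAnalytic ∧ f₁.IsReflexive ∧ f₁.shift = n₁) ∧
              (f₂.IsAnalytic ∧ f₂.IsReflexive ∧ f₂.shift = n₂) ∧
              f = f₁ * f₂⁻¹ ∧
              ∀ F : FormalDiffeo, f.IsIterator F →
                (f₁ = F⁻¹ * FormalDiffeo.l ^ n₁ * F.check ∧ f₁ = f ^ n₁ * F⁻¹ * F.check) ∧
                (f₂ = F⁻¹ * FormalDiffeo.l ^ n₂ * F.check ∧ f₂ = f ^ n₂ * F⁻¹ * F.check)) ∧
      -- bifactorisation, counitary case
      (f.IsWeaklyCounitary →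
        (∃ h : FormalDiffeo, h.IsAnalytic ∧ h.shift = 0 ∧ (h * f * h⁻¹).IsCounitary) ∧
        (PowerSeries.coeff 1 f.tail = 0 → ∃! F : FormalDiffeo, f.IsIterator F) ∧
        ∀ h : FormalDiffeo, h.IsAnalytic → h.shift = 0 → (h * f * h⁻¹).IsCounitary →
          ∀ n₁ n₂ : ℤ, n₁ - n₂ = 1 →
            ∀ f₁ f₂ : FormalDiffeo,
              f₁ = f.counitaryFactor h n₁ → f₂ = f.counitaryFactor h n₂ →
              (f₁.IsAnalytic ∧ f₁.IsCounitary ∧ f₁.shift = n₁) ∧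
              (f₂.IsAnalytic ∧ f₂.IsCounitary ∧ f₂.shift = n₂) ∧
              f = f₁ * f₂⁻¹ ∧
              ∀ F : FormalDiffeo, f.IsIterator F →
                (f₁ = F⁻¹ * FormalDiffeo.l ^ n₁ * F.bar.check ∧
                  f₁ = f ^ n₁ * F⁻¹ * F.bar.check) ∧
                (f₂ = F⁻¹ * FormalDiffeo.l ^ n₂ * F.bar.check ∧
                  f₂ = f ^ n₂ * F⁻¹ * F.bar.check)) ∧
      -- conjugacies that are not normalised: only the constant terms of the factors change
      (∀ h : FormalDiffeo, h.IsAnalytic → ∀ n₁ n₂ : ℤ, n₁ - n₂ = 1 →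
        ((h * f * h⁻¹).IsReflexive → ∀ f₁ f₂ : FormalDiffeo,
          f₁ = f.reflexiveFactor h n₁ → f₂ = f.reflexiveFactor h n₂ →
          (f₁.IsAnalytic ∧ f₁.IsReflexive ∧ f₁.shift = n₁ - 2 * h.shift) ∧
          (f₂.IsAnalytic ∧ f₂.IsReflexive ∧ f₂.shift = n₂ - 2 * h.shift) ∧
          f = f₁ * f₂⁻¹) ∧
        ((h * f * h⁻¹).IsCounitary → ∀ f₁ f₂ : FormalDiffeo,
          f₁ = f.counitaryFactor h n₁ → f₂ = f.counitaryFactor h n₂ →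
          (f₁.IsAnalytic ∧ f₁.IsCounitary ∧ f₁.shift = n₁ - 2 * (h.shift.re : ℂ)) ∧
          (f₂.IsAnalytic ∧ f₂.IsCounitary ∧ f₂.shift = n₂ - 2 * (h.shift.re : ℂ)) ∧
          f = f₁ * f₂⁻¹)) := by
  open FormalDiffeo in
  refine ⟨fun f₁ f₂ a₁ a₂ => ⟨isSymmetry_checkHom.exists_anConj_mul_and_mul_inv a₁ a₂,
    isSymmetry_barHom.exists_anConj_mul_and_mul_inv a₁ a₂,
    isSymmetry_checkHom_comp_barHom.exists_anConj_mul_and_mul_inv a₁ a₂⟩, fun f hf hs => ?_⟩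
  have hs0 : f.shift ≠ 0 := by simp [hs]
  refine ⟨fun hw => ⟨isSymmetry_checkHom.exists_conj_normalised hs0 hw,
    existsUnique_isIterator hs hw.coeff_one_eq_zero, ?_⟩,
    fun hw => ⟨isSymmetry_checkHom_comp_barHom.exists_conj_normalised hs0 hw,
      existsUnique_isIterator hs, ?_⟩, ?_⟩
  · rintro h ha h0 hc n₁ n₂ hn _ _ rfl rfl
    have hS := isSymmetry_checkHom
    exact ⟨⟨hS.isAnalytic_factor hf ha n₁, hS.map_factor hc n₁,
        by simp [shift_reflexiveFactor hs, h0]⟩,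
      ⟨hS.isAnalytic_factor hf ha n₂, hS.map_factor hc n₂,
        by simp [shift_reflexiveFactor hs, h0]⟩,
      eq_factor_mul_inv_factor f h _ hn,
      fun F hF => ⟨hS.factor_eq check_l h0 hc hF n₁, hS.factor_eq check_l h0 hc hF n₂⟩⟩
  · rintro h ha h0 hc n₁ n₂ hn _ _ rfl rfl
    have hS := isSymmetry_checkHom_comp_barHom
    have hl : checkHom.comp barHom l = l⁻¹ := (congrArg check bar_l).trans check_l
    exact ⟨⟨hS.isAnalytic_factor hf ha n₁, hS.map_factor hc n₁,
        by simp [shift_counitaryFactor hs, h0]⟩,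
      ⟨hS.isAnalytic_factor hf ha n₂, hS.map_factor hc n₂,
        by simp [shift_counitaryFactor hs, h0]⟩,
      eq_factor_mul_inv_factor f h _ hn,
      fun F hF => ⟨hS.factor_eq hl h0 hc hF n₁, hS.factor_eq hl h0 hc hF n₂⟩⟩
  · intro h ha n₁ n₂ hn
    constructor
    · rintro hc _ _ rfl rfl
      have hS := isSymmetry_checkHom
      exact ⟨⟨hS.isAnalytic_factor hf ha n₁, hS.map_factor hc n₁, shift_reflexiveFactor hs h n₁⟩,
        ⟨hS.isAnalytic_factor hf ha n₂, hS.map_factor hc n₂, shift_reflexiveFactor hs h n₂⟩,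
        eq_factor_mul_inv_factor f h _ hn⟩
    · rintro hc _ _ rfl rfl
      have hS := isSymmetry_checkHom_comp_barHom
      exact ⟨⟨hS.isAnalytic_factor hf ha n₁, hS.map_factor hc n₁, shift_counitaryFactor hs h n₁⟩,
        ⟨hS.isAnalytic_factor hf ha n₂, hS.map_factor hc n₂, shift_counitaryFactor hs h n₂⟩,
        eq_factor_mul_inv_factor f h _ hn⟩
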